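/- Let $k\ge 1$ be an integer and let $[k]^\omega=\bigcup_{n\ge1}[k]^n$ be the set of nonempty finite words over the alphabet $[k]=\{1,\dots,k\}$. A *variable word* is a finite word over $[k]\cup\{*\}$ in which the wildcard $*$ occurs; for a variable word $b$ and $a\in[k]$ let $b(a)\in[k]^\omega$ be the result of replacing every $*$ in $b$ by $a$. A *line* is a map $\ell:[k]\to[k]^\omega$, $\ell(a)=b(a)$, for a variable word $b$. A *subspace* is a map $\phi:[k]^\omega\to[k]^\omega$ of the form $\phi(v_1\cdots v_n)=b_1(v_1)b_2(v_2)\cdots b_n(v_n)$ (concatenation) for an infinite sequence $b_1,b_2,\dots$ of variable words. Let $(X,\Sigma)$ be a standard Borel space. A *law* on $X^{[k]^\omega}$ is a probability measure $\mu$ on the product space $(X^{[k]^\omega},\Sigma^{\otimes[k]^\omega})$; it is *strongly stationary* (s.s.) if for every subspace $\phi$ the law of $(x_{\phi(v)})_{v\in[k]^\omega}$ under $\mu$ is $\mu$. For an s.s. law all one-dimensional marginals $(\pi_w)_\#\mu$, $w\in[k]^\omega$, coincide; their common value is denoted $\mu^\circ$. An *extension* of $\mu$ is a law $\tilde\mu$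 on $\tilde X^{[k]^\omega}$, with $\tilde X$ standard Borel, together with a measurable map $\pi:\tilde X\to X$ such that the image of $\tilde\mu$ under the coordinatewise action of $\pi$ is $\mu$. For nonempty $e\subseteq[k]$ let $\Phi_e$ be the $\sigma$-algebra of all $A\in\Sigma$ such that for every line $\ell$ and all $i,j\in e$ one has $1_A(x_{\ell(i)})=1_A(x_{\ell(j)})$ for $\mu$-a.e. $x$. A function on $X$ is *$e$-insensitive* if it is $\Phi_e$-measurable. Let $\binom{[k]}{\ge2}$ be the family of subsets of $[k]$ with at least two elements. For an up-set $\mathcal I\subseteq\binom{[k]}{\ge2}$ (that is, $u\in\mathcal I$ and $u\subseteq v\subseteq[k]$ imply $v\in\mathcal I$) put $\Phi_{\mathcal I}=\bigvee_{u\in\mathcal I}\Phi_u$; write $\tilde\Phi_{\mathcal I}$ for the corresponding $\sigma$-algebra on $\tilde X$ defined from a law $\tilde\mu$. An s.s. law $\mu$ is *fully sated* if for every nonempty up-set $\mathcal I\subseteq\binom{[k]}{\ge2}$ and every s.s. extension $\tilde\mu$ of $\mu$ through $\pi:\tilde X\to X$, the $\sigma$-algebras $\pi^{-1}(\Sigma)$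 and $\tilde\Phi_{\mathcal I}$ are conditionally independent given $\pi^{-1}(\Phi_{\mathcal I})$ under $\tilde\mu^\circ$. **Lemma.** Let $\mu$ be a fully sated s.s. law on $X^{[k]^\omega}$, let $e\subseteq[k]$ with $|e|\ge2$, let $i\in e$, and let $f\in L^\infty(\mu^\circ)$ be real-valued and $e$-insensitive. Then, $\mu^\circ$-almost everywhere, $$\mathsf E_{\mu^\circ}\Big(f\,\Big|\,\bigvee_{j\in[k]\setminus e}\Phi_{\{i,j\}}\Big)=\mathsf E_{\mu^\circ}\Big(f\,\Big|\,\bigvee_{j\in[k]\setminus e}\Phi_{e\cup\{j\}}\Big),$$ where for $e=[k]$ the empty join is the trivial $\sigma$-algebra. -/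

import Mathlib

open MeasureTheory ProbabilityTheory
open scoped ENNReal

universe u

namespace DHJ

/-! ### Words, combinatorial lines and subspaces -/

/-- The infinite-dimensional combinatorial space `[k]^ω = ⋃_{n ≥ 1} [k]^n` of nonempty finite
words over the alphabet `[k]`, the letters being the elements of `Fin k`. -/
abbrev Word (k : ℕ) : Type := {v : List (Fin k) // v ≠ []}

/-- A variable word: a finite word over `[k]` together with a wildcard (`none`), in which the
wildcard occurs at least once. The positions of the wildcard form the nonempty set `I` and the
other positions carry the fixed letters. -/
structure VarWord (k : ℕ) where
  /-- the symbols of the variable word -/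
  symbols : List (Option (Fin k))
  /-- the wildcard occurs -/
  wildcard_mem : none ∈ symbols

/-- Substitute the letter `a` for the wildcard. -/
def VarWord.subst {k : ℕ} (b : VarWord k) (a : Fin k) : List (Fin k) :=
  b.symbols.map fun s => s.getD a

theorem VarWord.subst_ne_nil {k : ℕ} (b : VarWord k) (a : Fin k) : b.subst a ≠ [] := by
  have h := b.wildcard_mem
  intro h0
  simp only [VarWord.subst, List.map_eq_nil_iff] at h0
  simp [h0] at h

/-- The combinatorial line `ℓ : [k] → [k]^N` given by a variable word of length `N`. -/
def VarWord.line {k : ℕ} (b : VarWord k) (a : Fin k) : Word k := ⟨b.subst a, b.subst_ne_nil a⟩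

/-- The infinite-dimensional subspace `φ : [k]^ω → [k]^ω` given by a sequence `b 0, b 1, …` of
variable words: `φ(v₀ v₁ ⋯ vₙ)` is the concatenation of the blocks `b i` with `vᵢ` substituted
for the wildcard. (The block `b i` occupies the positions `N_i + 1, …, N_{i+1}`, and its wildcards
are the positions in `I_{i+1}`.) -/
def subspaceMap {k : ℕ} (b : ℕ → VarWord k) (v : Word k) : Word k :=
  ⟨(v.1.mapIdx fun i a => (b i).subst a).flatten, by
    obtain ⟨v, hv⟩ := v
    cases v with
    | nil => exact absurd rfl hv
    | cons a v => simp [List.mapIdx_cons, VarWord.subst_ne_nil]⟩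

/-! ### Laws

A law on `X^{[k]^ω}` is a probability measure on `Word k → X` with its product σ-algebra. -/

variable {k : ℕ} {X : Type u} [MeasurableSpace X]

/-- Strong stationarity: `φ^* μ = μ` for every subspace `φ : [k]^ω → [k]^ω`, where `φ^* μ` is the
law of `(x_{φ(v)})_v` under `μ`. -/
def StronglyStationary (μ : Measure (Word k → X)) : Prop :=
  ∀ b : ℕ → VarWord k, μ.map (fun x v => x (subspaceMap b v)) = μ

/-- The one-letter word `0`. -/
def baseWord (k : ℕ) [NeZero k] : Word k := ⟨[0], by simp⟩

/-- The point marginal `μ°`: the law of a single coordinate. For a strongly stationary law it does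
not depend on the coordinate, see `StronglyStationary.map_eval`. -/
noncomputable def pointMarginal [NeZero k] (μ : Measure (Word k → X)) : Measure X :=
  μ.map fun x => x (baseWord k)

instance pointMarginal_isProbabilityMeasure [NeZero k] (μ : Measure (Word k → X))
    [IsProbabilityMeasure μ] : IsProbabilityMeasure (pointMarginal μ) :=
  Measure.isProbabilityMeasure_map (measurable_pi_apply _).aemeasurable

/-- The points of a line with the same parameter have the same law. -/
theorem StronglyStationary.map_eval_line {μ : Measure (Word k → X)} (h : StronglyStationary μ)
    (b : VarWord k) (a : Fin k) :
    μ.map (fun x => x (b.line a)) = μ.map (fun x => x ⟨[a], by simp⟩) := by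
  have key := Measure.map_map (μ := μ)
    (f := fun (x : Word k → X) (v : Word k) => x (subspaceMap (fun _ => b) v))
    (g := fun x : Word k → X => x ⟨[a], by simp⟩)
    (measurable_pi_apply (⟨[a], by simp⟩ : Word k))
    (measurable_pi_lambda _ fun _ => measurable_pi_apply _)
  rw [h fun _ => b] at key
  rw [key]
  congr 1
  funext x
  simp [subspaceMap, VarWord.line]

/-- All one-dimensional marginals of a strongly stationary law coincide. -/
theorem StronglyStationary.map_eval [NeZero k] {μ : Measure (Word k → X)}
    (h : StronglyStationary μ) (w : Word k) :
    μ.map (fun x => x w) = pointMarginal μ := by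
  obtain ⟨w, hw⟩ := w
  cases w with
  | nil => exact absurd rfl hw
  | cons a w =>
    have h1 := h.map_eval_line ⟨none :: w.map some, by simp⟩ a
    have h2 := h.map_eval_line ⟨[none, some 0], by simp⟩ a
    have h3 := h.map_eval_line ⟨[some a, none], by simp⟩ 0
    simp only [VarWord.line, VarWord.subst, List.map_cons, List.map_map, Option.getD_none,
      Option.getD_some, Function.comp_def, List.map_id', List.map_nil] at h1 h2 h3
    rw [h1, ← h2, h3]
    rfl

/-- `ν` is an extension of `μ` through the factor `π`: the coordinate-wise image of `ν` under the
measurable map `π` is `μ`. -/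
structure IsExtension {Y : Type u} [MeasurableSpace Y] (ν : Measure (Word k → Y))
    (μ : Measure (Word k → X)) (π : Y → X) : Prop where
  measurable : Measurable π
  map_eq : ν.map (fun y w => π (y w)) = μ

/-! ### Partially insensitive σ-algebras -/

/-- The `e`-insensitive σ-algebra `Φ_e` of a law `μ`: the measurable `A ⊆ X` such that, for every
line `ℓ` and all `i, j ∈ e`, `1_A(x_{ℓ(i)}) = 1_A(x_{ℓ(j)})` for `μ`-almost every `x`. -/
@[reducible] def insensitive (μ : Measure (Word k → X)) (e : Finset (Fin k)) : MeasurableSpace X where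
  MeasurableSet' A := MeasurableSet A ∧ ∀ ℓ : VarWord k, ∀ i ∈ e, ∀ j ∈ e,
    ∀ᵐ x ∂μ, x (ℓ.line i) ∈ A ↔ x (ℓ.line j) ∈ A
  measurableSet_empty := ⟨MeasurableSet.empty, by simp⟩
  measurableSet_compl A hA := ⟨hA.1.compl, fun ℓ i hi j hj => by
    filter_upwards [hA.2 ℓ i hi j hj] with x hx
    simp only [Set.mem_compl_iff, hx]⟩
  measurableSet_iUnion A hA := ⟨MeasurableSet.iUnion fun n => (hA n).1, fun ℓ i hi j hj => by
    filter_upwards [ae_all_iff.2 fun n => (hA n).2 ℓ i hi j hj] with x hx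
    simp only [Set.mem_iUnion, hx]⟩

theorem insensitive_le (μ : Measure (Word k → X)) (e : Finset (Fin k)) :
    insensitive μ e ≤ ‹MeasurableSpace X› := fun _ hA => hA.1

/-- A function on `X` is `e`-insensitive if it is `Φ_e`-measurable. -/
def IsInsensitive (μ : Measure (Word k → X)) (e : Finset (Fin k)) (f : X → ℝ) : Prop :=
  Measurable[insensitive μ e] f

/-- An up-set in the family of the subsets of `[k]` with at least two elements. -/
structure IsUpFamily (I : Set (Finset (Fin k))) : Prop where
  two_le_card : ∀ u ∈ I, 2 ≤ u.card
  mem_of_subset : ∀ u ∈ I, ∀ v : Finset (Fin k), u ⊆ v → v ∈ I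

/-- `Φ_I = ⋁_{u ∈ I} Φ_u`. -/
@[reducible] def familyInsensitive (μ : Measure (Word k → X)) (I : Set (Finset (Fin k))) : MeasurableSpace X :=
  ⨆ u ∈ I, insensitive μ u

theorem familyInsensitive_le (μ : Measure (Word k → X)) (I : Set (Finset (Fin k))) :
    familyInsensitive μ I ≤ ‹MeasurableSpace X› :=
  iSup₂_le fun u _ => insensitive_le μ u

theorem comap_familyInsensitive_le {Y : Type u} [MeasurableSpace Y] (μ : Measure (Word k → X))
    (I : Set (Finset (Fin k))) {π : Y → X} (hπ : Measurable π) :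
    (familyInsensitive μ I).comap π ≤ ‹MeasurableSpace Y› :=
  (MeasurableSpace.comap_mono (familyInsensitive_le μ I)).trans hπ.comap_le

/-! ### Satedness -/

/-- `μ` is `I`-sated: for every strongly stationary extension `ν` of `μ` through a factor
`π : Y → X`, `Y` standard Borel, the σ-algebra generated by `π` and the σ-algebra `Φ_I` of `ν` are
relatively independent under `ν°` over `π⁻¹(Φ_I)`, `Φ_I` here being that of `μ`. (Every standard
Borel space is isomorphic to one in the universe of `X`.) -/
def IsSated [NeZero k] (μ : Measure (Word k → X)) (I : Set (Finset (Fin k))) : Prop :=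
  ∀ (Y : Type u) [MeasurableSpace Y] [StandardBorelSpace Y] (ν : Measure (Word k → Y))
    [IsProbabilityMeasure ν] (π : Y → X) (hπ : IsExtension ν μ π), StronglyStationary ν →
    CondIndep ((familyInsensitive μ I).comap π)
      (MeasurableSpace.comap π ‹MeasurableSpace X›) (familyInsensitive ν I)
      (comap_familyInsensitive_le μ I hπ.measurable) (pointMarginal ν)

/-- `μ` is fully sated: it is `I`-sated for every nonempty up-set `I`. -/
def FullySated [NeZero k] (μ : Measure (Word k → X)) : Prop :=
  ∀ I : Set (Finset (Fin k)), IsUpFamily I → I.Nonempty → IsSated μ I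

end DHJ

/-! Let g be `collapse e i`, let H be the join of the Φ_{e ∪ {j}} and G that of the Φ_{i,j}, j ∉ e,
and put d = f - E(f | H). As H ⊆ G, it suffices that d has zero integral over every B ∈ G. Since H ⊆
Φ_e, d is e-insensitive, so d(x_w) = d(x_{g w}) almost surely. Couple the two processes x_w and x_{g
w}. A set of Φ_{i,j}, read in the second coordinate, becomes e ∪ {j}-insensitive, because g maps e ∪
{j} into {i, j}. If the coupling ν is a strongly stationary extension of μ through the first
coordinate, satedness makes d(y₁) orthogonal to the event y₂ ∈ B, and ∫_B d dμ° = ∫ 1_B(y₂) d(y₂)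
dν° = ∫ 1_B(y₂) d(y₁) dν° = 0.

The law of the pairs (x_w, x_{g w}) need not be strongly stationary: g ∘ φ = φ' ∘ g, where φ' has
its fixed letters changed by g. `exists_coupling` therefore passes to a limit along subspaces. Both
marginal processes keep their laws, and the almost sure equality d(y₁) = d(y₂) survives by
approximating d in L¹ by continuous functions.

The limit is strongly stationary because it is taken along an ultrafilter of subspaces that does not
notice composition with a fixed subspace (`exists_ultrafilter_subspace`). Its blocks are chosen
independently from an ultrafilter p on variable words, in the sense of iterated limits. Composition
concatenates blocks with and without substituted letters. It returns p-generic blocks since p is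
idempotent, substitution of any letter sends p to an idempotent q, and pq = qp = p. Such a pair
arises from a minimal idempotent q and an idempotent p below it: a substitution image of p is an
idempotent below q, hence equals q. -/

namespace DHJ

/-! ### Idempotents in compact right topological semigroups -/

section Semigroup

variable {M : Type*} [Semigroup M] [TopologicalSpace M] [CompactSpace M] [T2Space M]

/-- A closed nonempty subsemigroup contains an idempotent `q` which is minimal: the only idempotent
`r` of it with `r * q = q * r = r` is `q` itself. -/
theorem exists_minimal_idempotent (hM : ∀ r : M, Continuous (· * r)) {C : Set M}
    (hC : IsClosed C) (hne : C.Nonempty) (hmul : ∀ x ∈ C, ∀ y ∈ C, x * y ∈ C) :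
    ∃ q ∈ C, q * q = q ∧ ∀ r ∈ C, r * r = r → r * q = r → q * r = r → r = q := by
  -- The closed left ideals of `C`; a minimal one exists by Zorn and compactness.
  let S : Set (Set M) := {L | IsClosed L ∧ L.Nonempty ∧ L ⊆ C ∧ ∀ x ∈ C, ∀ y ∈ L, x * y ∈ L}
  obtain ⟨L, -, hL⟩ : ∃ L, L ⊆ C ∧ Minimal (· ∈ S) L := by
    refine zorn_superset_nonempty S (fun c hcS hc hcne => ?_) C ⟨hC, hne, subset_rfl, hmul⟩
    refine ⟨⋂₀ c, ⟨isClosed_sInter fun t ht => (hcS ht).1, ?_, ?_, ?_⟩,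
      fun s hs => Set.sInter_subset_of_mem hs⟩
    · have := hcne.to_subtype
      rw [Set.sInter_eq_iInter]
      exact IsCompact.nonempty_iInter_of_directed_nonempty_isCompact_isClosed _
        (DirectedOn.directed_val (IsChain.directedOn hc.symm)) (fun i => (hcS i.2).2.1)
        (fun i => (hcS i.2).1.isCompact) (fun i => (hcS i.2).1)
    · obtain ⟨t, ht⟩ := hcne
      exact (Set.sInter_subset_of_mem ht).trans (hcS ht).2.2.1
    · exact fun x hx y hy => Set.mem_sInter.2 fun t ht =>
        (hcS ht).2.2.2 x hx y (Set.mem_sInter.1 hy t ht)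
  obtain ⟨hLc, hLne, hLC, hLmul⟩ := hL.prop
  obtain ⟨q, hqL, hqq⟩ := exists_idempotent_in_compact_subsemigroup hM L hLne hLc.isCompact
    fun x hx y hy => hLmul x (hLC hx) y hy
  refine ⟨q, hLC hqL, hqq, fun r hrC hrr hrq hqr => ?_⟩
  have hr : r ∈ L := hrq ▸ hLmul r hrC q hqL
  -- `C * r` is a closed left ideal inside the minimal `L`. Hence q = s * r for some s, and q * r =
  -- q.
  have hsub : (· * r) '' C = L := by
    refine hL.eq_of_subset ⟨(hM r).isClosedMap _ hC, ⟨_, r, hrC, rfl⟩, ?_, ?_⟩ ?_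
    · rintro _ ⟨s, hs, rfl⟩
      exact hmul s hs r hrC
    · rintro x hx _ ⟨s, hs, rfl⟩
      exact ⟨x * s, hmul x hx s hs, mul_assoc _ _ _⟩
    · rintro _ ⟨s, hs, rfl⟩
      exact hLmul s hs r hr
  obtain ⟨s, -, hs⟩ : q ∈ (· * r) '' C := hsub ▸ hqL
  rw [← hqr, ← hs]
  simp only [mul_assoc, hrr]

/-- Below an idempotent `q` there is an idempotent `p` in every closed set `V` which is stable under
products and under multiplication by `q`. -/
theorem exists_idempotent_le (hM : ∀ r : M, Continuous (· * r)) {V : Set M} (hV : IsClosed V)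
    (hne : V.Nonempty) (hmul : ∀ x ∈ V, ∀ y ∈ V, x * y ∈ V) {q : M} (hqq : q * q = q)
    (hVq : ∀ x ∈ V, x * q ∈ V) (hqV : ∀ x ∈ V, q * x ∈ V) :
    ∃ p ∈ V, p * p = p ∧ p * q = p ∧ q * p = p := by
  -- An idempotent of `V * q` absorbs `q` on the right; multiplying it by `q` on the left gives the
  -- other side and keeps it idempotent.
  obtain ⟨t, ht, htt⟩ := exists_idempotent_in_compact_subsemigroup hM ((· * q) '' V)
    (hne.image _) ((hM q).isClosedMap _ hV).isCompact (by
      rintro _ ⟨x, hx, rfl⟩ _ ⟨y, hy, rfl⟩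
      exact ⟨x * q * y, hmul _ (hVq x hx) _ hy, by simp only [mul_assoc]⟩)
  have htq : t * q = t := by
    obtain ⟨x, -, rfl⟩ := ht
    simp only [mul_assoc, hqq]
  have htV : t ∈ V := by
    obtain ⟨x, hx, rfl⟩ := ht
    exact hVq x hx
  refine ⟨q * t, hqV t htV, ?_, ?_, ?_⟩
  · rw [mul_assoc, ← mul_assoc t q t, htq, htt]
  · rw [mul_assoc, htq]
  · rw [← mul_assoc, hqq]

end Semigroup

/-! ### Ultrafilters on words with wildcards -/

/-- Replace the wildcard by `a` in a word over `[k] ∪ {*}`. -/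
def fill {k : ℕ} (a : Fin k) (w : List (Option (Fin k))) : List (Option (Fin k)) :=
  w.map fun s => some (s.getD a)

section Ultrafilter

attribute [local instance] Ultrafilter.semigroup

theorem map_mul_ultrafilter {M N : Type*} [Semigroup M] [Semigroup N] (f : M →ₙ* N)
    (U V : Ultrafilter M) : (U * V).map f = U.map f * V.map f := by
  refine Ultrafilter.coe_inj.1 (Filter.ext' fun P => ?_)
  rw [Ultrafilter.eventually_mul]
  simp only [Ultrafilter.coe_map, Filter.eventually_map]
  rw [Ultrafilter.eventually_mul]
  simp

/-- There are idempotent ultrafilters `p` on the variable words and `q` on the words without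
wildcards, with `p` absorbing `q` on both sides, such that substituting any letter for the wildcard
maps `p` to `q`. -/
theorem exists_ultrafilter_words (k : ℕ) [NeZero k] :
    ∃ p q : Ultrafilter (List (Option (Fin k))),
      (∀ᶠ w in (p : Filter (List (Option (Fin k)))), none ∈ w) ∧
      (∀ P : List (Option (Fin k)) → Prop,
        (∀ᶠ u in p, ∀ᶠ v in p, P (u ++ v)) ↔ ∀ᶠ u in p, P u) ∧
      (∀ P : List (Option (Fin k)) → Prop,
        (∀ᶠ u in p, ∀ᶠ v in q, P (u ++ v)) ↔ ∀ᶠ u in p, P u) ∧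
      (∀ P : List (Option (Fin k)) → Prop,
        (∀ᶠ u in q, ∀ᶠ v in p, P (u ++ v)) ↔ ∀ᶠ u in p, P u) ∧
      (∀ P : List (Option (Fin k)) → Prop,
        (∀ᶠ u in q, ∀ᶠ v in q, P (u ++ v)) ↔ ∀ᶠ u in q, P u) ∧
      ∀ (a : Fin k) (P : List (Option (Fin k)) → Prop),
        (∀ᶠ u in p, P (fill a u)) ↔ ∀ᶠ u in q, P u := by
  let _ : Semigroup (List (Option (Fin k))) :=
    { mul := fun u v => u ++ v
      mul_assoc := List.append_assoc }
  have hmul : ∀ u v : List (Option (Fin k)), u * v = u ++ v := fun _ _ => rfl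
  have hM : ∀ r : Ultrafilter (List (Option (Fin k))), Continuous (· * r) :=
    Ultrafilter.continuous_mul_left
  let W : Set (List (Option (Fin k))) := {w | none ∉ w}
  have hWc : IsClosed {U : Ultrafilter (List (Option (Fin k))) | W ∈ U} :=
    ultrafilter_isClosed_basic W
  have hVc : IsClosed {U : Ultrafilter (List (Option (Fin k))) | Wᶜ ∈ U} :=
    ultrafilter_isClosed_basic Wᶜ
  have hmem : ∀ (U V : Ultrafilter (List (Option (Fin k)))) (A B D : Set (List (Option (Fin k)))),
      A ∈ U → B ∈ V → (∀ x ∈ A, ∀ y ∈ B, x * y ∈ D) → D ∈ U * V := by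
    intro U V A B D hA hB h
    change ∀ᶠ x in ((U * V : Ultrafilter _) : Filter (List (Option (Fin k)))), x ∈ D
    rw [Ultrafilter.eventually_mul]
    filter_upwards [hA] with x hx
    filter_upwards [hB] with y hy
    exact h x hx y hy
  obtain ⟨q, hqW, hqq, hqmin⟩ := exists_minimal_idempotent hM hWc
    ⟨pure ([] : List (Option (Fin k))), by simp [W]⟩ (fun U hU V hV => hmem U V W W W hU hV
      (fun x hx y hy => by simp_all [W]))
  obtain ⟨p, hpV, hpp, hpq, hqp⟩ := exists_idempotent_le hM hVc
    ⟨pure ([none] : List (Option (Fin k))), by simp [W]⟩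
    (fun U hU V hV => hmem U V Wᶜ Wᶜ Wᶜ hU hV (fun x hx y hy => by simp_all [W])) hqq
    (fun U hU => hmem U q Wᶜ W Wᶜ hU hqW (fun x hx y hy => by simp_all [W]))
    (fun U hU => hmem q U W Wᶜ Wᶜ hqW hU (fun x hx y hy => by simp_all [W]))
  have key : ∀ {U V T : Ultrafilter (List (Option (Fin k)))}, U * V = T →
      ∀ P : List (Option (Fin k)) → Prop,
      (∀ᶠ u in U, ∀ᶠ v in V, P (u ++ v)) ↔ ∀ᶠ u in T, P u := by
    rintro U V _ rfl P
    exact (Ultrafilter.eventually_mul U V P).symm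
  refine ⟨p, q, ?_, key hpp, key hpq, key hqp, key hqq, fun a P => ?_⟩
  · filter_upwards [hpV] with x hx
    exact not_not.1 hx
  · let σ : List (Option (Fin k)) →ₙ* List (Option (Fin k)) := ⟨fill a, fun u v => List.map_append⟩
    have hσW : ∀ w, σ w ∈ W := fun w => by
      change none ∉ List.map _ (w : List (Option (Fin k)))
      simp
    have hσq : q.map σ = q := by
      have h : ∀ᶠ w in (q : Filter (List (Option (Fin k)))), σ w = w := by
        filter_upwards [hqW] with w hw
        change List.map _ (w : List (Option (Fin k))) = w
        refine (List.map_congr_left fun s hs => ?_).trans (List.map_id _)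
        cases s with
        | none => exact absurd hs hw
        | some b => rfl
      refine Ultrafilter.coe_inj.1 ?_
      rw [Ultrafilter.coe_map, Filter.map_congr h]
      exact Filter.map_id
    -- The image is an idempotent on words without wildcards and lies below `q`, since σ fixes `q`;
    -- minimality applies.
    have hσp : p.map σ = q := by
      refine hqmin _ ?_ ?_ ?_ ?_
      · change σ ⁻¹' W ∈ p
        exact Filter.univ_mem' hσW
      · rw [← map_mul_ultrafilter, hpp]
      · have h := map_mul_ultrafilter σ p q
        rw [hpq, hσq] at h
        exact h.symm
      · have h := map_mul_ultrafilter σ q p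
        rw [hqp, hσq] at h
        exact h.symm
    rw [← hσp]
    rfl

end Ultrafilter

/-! ### Iterated limits along sequences of blocks -/

section Blocks

variable {S : Type*}

/-- The `n`-fold tensor power of an ultrafilter, as an ultrafilter on lists. -/
def blocks (p : Ultrafilter S) : ℕ → Ultrafilter (List S)
  | 0 => pure []
  | n + 1 => p.bind fun b => (blocks p n).map (b :: ·)

variable (p : Ultrafilter S)

theorem eventually_blocks_zero (P : List S → Prop) : (∀ᶠ l in blocks p 0, P l) ↔ P [] :=
  Iff.rfl

theorem eventually_blocks_succ (n : ℕ) (P : List S → Prop) :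
    (∀ᶠ l in blocks p (n + 1), P l) ↔ ∀ᶠ b in p, ∀ᶠ l in blocks p n, P (b :: l) :=
  Iff.rfl

theorem eventually_blocks_add (m n : ℕ) (P : List S → Prop) :
    (∀ᶠ l in blocks p (m + n), P l) ↔ ∀ᶠ l in blocks p m, ∀ᶠ l' in blocks p n, P (l ++ l') := by
  induction m generalizing P with
  | zero => rw [Nat.zero_add, eventually_blocks_zero]; rfl
  | succ m ih =>
    rw [Nat.add_right_comm, eventually_blocks_succ, eventually_blocks_succ]
    simp only [ih, List.cons_append]

theorem eventually_blocks_length (n : ℕ) : ∀ᶠ l : List S in blocks p n, l.length = n := by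
  induction n with
  | zero => exact (eventually_blocks_zero _ _).2 rfl
  | succ n ih =>
    rw [eventually_blocks_succ]
    refine Filter.Eventually.of_forall fun b => ?_
    filter_upwards [ih] with l hl
    simp [hl]

theorem eventually_blocks_forall {Q : S → Prop} (hQ : ∀ᶠ b in p, Q b) (n : ℕ) :
    ∀ᶠ l : List S in blocks p n, ∀ b ∈ l, Q b := by
  induction n with
  | zero => exact (eventually_blocks_zero _ _).2 (by simp)
  | succ n ih =>
    rw [eventually_blocks_succ]
    filter_upwards [hQ] with b hb
    filter_upwards [ih] with l hl
    simpa using ⟨hb, hl⟩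

/-- Initial segments of generic block sequences are generic, so the total length is irrelevant to
properties of the first blocks. -/
theorem eventually_blocks_take (m n : ℕ) (hmn : m ≤ n) (P : List S → Prop) :
    (∀ᶠ l : List S in blocks p n, P (l.take m)) ↔ ∀ᶠ l in blocks p m, P l := by
  obtain ⟨n, rfl⟩ := Nat.exists_eq_add_of_le hmn
  rw [eventually_blocks_add]
  refine Filter.eventually_congr ?_
  filter_upwards [eventually_blocks_length p m] with l hl
  simp [← hl]

end Blocks

/-! ### Composition of subspaces in terms of blocks -/

variable {k : ℕ}

/-- Substitute the letters of `d` for the wildcards in the blocks `l`, leaving the wildcards of `l`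
at the positions of the wildcards of `d`, and concatenate. -/
def combine : List (Option (Fin k)) → List (List (Option (Fin k))) → List (Option (Fin k))
  | none :: d, b :: l => b ++ combine d l
  | some a :: d, b :: l => fill a b ++ combine d l
  | _, _ => []

/-- The blocks of the composition of the subspaces with blocks `l` and with blocks `ds`. -/
def combineAll : List (List (Option (Fin k))) → List (List (Option (Fin k))) →
    List (List (Option (Fin k)))
  | [], _ => []
  | d :: ds, l => combine d (l.take d.length) :: combineAll ds (l.drop d.length)

/-- Substitute the letters of `v` for the wildcards in the successive blocks `l`. -/
def substitute : List (List (Option (Fin k))) → List (Fin k) → List (Fin k)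
  | b :: l, a :: v => b.map (fun s => s.getD a) ++ substitute l v
  | _, _ => []

theorem map_getD_fill (a c : Fin k) (b : List (Option (Fin k))) :
    (fill a b).map (fun s => s.getD c) = b.map fun s => s.getD a := by
  simp [fill]

theorem substitute_nil (l : List (List (Option (Fin k)))) : substitute l [] = [] := by
  cases l <;> rfl

theorem substitute_append (l : List (List (Option (Fin k)))) (u w : List (Fin k))
    (h : u.length ≤ l.length) :
    substitute l (u ++ w) = substitute (l.take u.length) u ++ substitute (l.drop u.length) w := by
  induction u generalizing l with
  | nil => simp [substitute]
  | cons a u ih =>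
    cases l with
    | nil => simp at h
    | cons b l => simp [substitute, ih l (by simpa using h)]

theorem substitute_map_getD (d : List (Option (Fin k))) (l : List (List (Option (Fin k))))
    (h : l.length = d.length) (a : Fin k) :
    substitute l (d.map fun s => s.getD a) = (combine d l).map fun s => s.getD a := by
  induction d generalizing l with
  | nil => simp [substitute_nil, combine]
  | cons s d ih =>
    cases l with
    | nil => simp at h
    | cons b l =>
      have := ih l (by simpa using h)
      cases s <;> simp [substitute, combine, this, map_getD_fill]

/-- The length hypothesis ensures that no block of `ds` runs out of blocks of `l`, where `combine`
would truncate. -/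
theorem substitute_substitute (ds l : List (List (Option (Fin k)))) (v : List (Fin k))
    (h : (ds.map List.length).sum ≤ l.length) :
    substitute l (substitute ds v) = substitute (combineAll ds l) v := by
  induction ds generalizing l v with
  | nil => simp [substitute, combineAll, substitute_nil]
  | cons d ds ih =>
    cases v with
    | nil => simp [substitute_nil]
    | cons a v =>
      simp only [List.map_cons, List.sum_cons] at h
      simp only [substitute, combineAll]
      rw [substitute_append _ _ _ (by simp; omega), List.length_map,
        substitute_map_getD _ _ (by simp; omega), ih _ _ (by simp; omega)]

theorem length_substitute_le (ds : List (List (Option (Fin k)))) (v : List (Fin k)) :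
    (substitute ds v).length ≤ (ds.map List.length).sum := by
  induction ds generalizing v with
  | nil => simp [substitute]
  | cons d ds ih => cases v <;> simp [substitute, ih]

theorem substitute_take (l : List (List (Option (Fin k)))) (v : List (Fin k)) (m : ℕ)
    (h : v.length ≤ m) : substitute (l.take m) v = substitute l v := by
  induction v generalizing l m with
  | nil => simp [substitute_nil]
  | cons a v ih =>
    obtain ⟨m, rfl⟩ : ∃ m', m = m' + 1 := ⟨m - 1, by simp at h; omega⟩
    cases l with
    | nil => simp
    | cons b l => simp [substitute, ih l m (by simpa using h)]

theorem subspaceMap_eq_substitute (b : ℕ → VarWord k) (l : List (List (Option (Fin k))))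
    (v : Word k) (h : ∀ i < v.1.length, l[i]? = some (b i).symbols) :
    (subspaceMap b v).1 = substitute l v.1 := by
  obtain ⟨v, hv⟩ := v
  simp only [subspaceMap] at h ⊢
  clear hv
  induction v generalizing b l with
  | nil => simp [substitute_nil]
  | cons a v ih =>
    cases l with
    | nil => simpa using h 0 (by simp)
    | cons s l =>
      have h0 := h 0 (by simp)
      simp only [List.getElem?_cons_zero, Option.some.injEq] at h0
      rw [List.mapIdx_cons, List.flatten_cons, substitute,
        ih (fun i => b (i + 1)) l fun i hi => by simpa using h (i + 1) (by simpa using hi), h0]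
      rfl

/-- The sequence of variable words whose first terms are the given blocks. -/
def toSeq (l : List (List (Option (Fin k)))) (i : ℕ) : VarWord k :=
  if h : none ∈ l.getD i [] then ⟨l.getD i [], h⟩ else ⟨[none], by simp⟩

theorem subspaceMap_toSeq (l : List (List (Option (Fin k)))) (hl : ∀ b ∈ l, none ∈ b) (v : Word k)
    (h : v.1.length ≤ l.length) : (subspaceMap (toSeq l) v).1 = substitute l v.1 := by
  refine subspaceMap_eq_substitute _ _ _ fun i hi => ?_
  have hil : i < l.length := hi.trans_le h
  have : none ∈ l.getD i [] := by
    rw [List.getD_eq_getElem _ _ hil]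
    exact hl _ (List.getElem_mem hil)
  simp only [toSeq, this, dif_pos]
  simp [hil]

/-- The combined block is a product of generic factors, p for each wildcard of `d` and q for each
letter. Such a product collapses to p as soon as one factor is p, and otherwise to q. -/
theorem eventually_combine {p q : Ultrafilter (List (Option (Fin k)))}
    (hpp : ∀ P : List (Option (Fin k)) → Prop,
        (∀ᶠ u in p, ∀ᶠ v in p, P (u ++ v)) ↔ ∀ᶠ u in p, P u)
    (hpq : ∀ P : List (Option (Fin k)) → Prop,
        (∀ᶠ u in p, ∀ᶠ v in q, P (u ++ v)) ↔ ∀ᶠ u in p, P u)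
    (hqp : ∀ P : List (Option (Fin k)) → Prop,
        (∀ᶠ u in q, ∀ᶠ v in p, P (u ++ v)) ↔ ∀ᶠ u in p, P u)
    (hqq : ∀ P : List (Option (Fin k)) → Prop,
        (∀ᶠ u in q, ∀ᶠ v in q, P (u ++ v)) ↔ ∀ᶠ u in q, P u)
    (hfill : ∀ (a : Fin k) (P : List (Option (Fin k)) → Prop),
        (∀ᶠ u in p, P (fill a u)) ↔ ∀ᶠ u in q, P u) (d : List (Option (Fin k))) :
    (none ∈ d → ∀ P : List (Option (Fin k)) → Prop,
      (∀ᶠ l in blocks p d.length, P (combine d l)) ↔ ∀ᶠ b in p, P b) ∧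
    (none ∉ d → d ≠ [] → ∀ P : List (Option (Fin k)) → Prop,
      (∀ᶠ l in blocks p d.length, P (combine d l)) ↔ ∀ᶠ b in q, P b) := by
  induction d with
  | nil => simp
  | cons s d ih =>
    have hd : none ∈ d ∨ d = [] ∨ (none ∉ d ∧ d ≠ []) := by tauto
    cases s with
    | none =>
      refine ⟨fun _ P => ?_, fun h => by simp at h⟩
      rw [List.length_cons, eventually_blocks_succ]
      simp only [combine]
      obtain h | rfl | ⟨h, h'⟩ := hd
      · simp only [fun u => ih.1 h fun w => P (u ++ w), hpp]
      · simp [combine]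
      · simp only [fun u => ih.2 h h' fun w => P (u ++ w), hpq]
    | some a =>
      constructor
      · intro h P
        rw [List.length_cons, eventually_blocks_succ]
        simp only [combine, fun u => ih.1 (by simpa using h) fun w => P (u ++ w)]
        rw [hfill a fun u => ∀ᶠ v in p, P (u ++ v), hqp]
      · intro h _ P
        rw [List.length_cons, eventually_blocks_succ]
        simp only [combine]
        rw [hfill a fun u => ∀ᶠ l in blocks p d.length, P (u ++ combine d l)]
        obtain h | rfl | ⟨h, h'⟩ := hd
        · simp_all
        · simp [combine]
        · simp only [fun u => ih.2 h h' fun w => P (u ++ w), hqq]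

theorem eventually_combineAll {p : Ultrafilter (List (Option (Fin k)))}
    (ds : List (List (Option (Fin k))))
    (h : ∀ d ∈ ds, ∀ P : List (Option (Fin k)) → Prop,
      (∀ᶠ l in blocks p d.length, P (combine d l)) ↔ ∀ᶠ b in p, P b)
    (P : List (List (Option (Fin k))) → Prop) :
    (∀ᶠ l in blocks p (ds.map List.length).sum, P (combineAll ds l)) ↔
      ∀ᶠ l in blocks p ds.length, P l := by
  induction ds generalizing P with
  | nil => simp [combineAll, eventually_blocks_zero]
  | cons d ds ih =>
    rw [List.map_cons, List.sum_cons, eventually_blocks_add, List.length_cons,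
      eventually_blocks_succ, ← h d (by simp)]
    refine Filter.eventually_congr ?_
    filter_upwards [eventually_blocks_length p d.length] with l hl
    rw [← ih fun d hd => h d (by simp [hd])]
    simp [combineAll, ← hl]

/-- There is an ultrafilter on the set of subspaces such that a generic subspace `φ` is
indistinguishable from its compositions `φ ∘ ψ`, by the properties which depend only on the images of
the words of bounded length. -/
theorem exists_ultrafilter_subspace (k : ℕ) [NeZero k] :
    ∃ F : Ultrafilter (ℕ → VarWord k), ∀ (d : ℕ → VarWord k) (n : ℕ) (P : (Word k → Word k) → Prop),
      (∀ φ φ' : Word k → Word k, (∀ v : Word k, v.1.length ≤ n → φ v = φ' v) → P φ → P φ') →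
      ((∀ᶠ b in F, P fun v => subspaceMap b (subspaceMap d v)) ↔
        ∀ᶠ b in F, P (subspaceMap b)) := by
  obtain ⟨p, q, hp, hpp, hpq, hqp, hqq, hfill⟩ := exists_ultrafilter_words k
  -- Take `N` generic blocks with `N` tending to infinity; the padding by `toSeq` beyond `N` is
  -- never seen by words of bounded length.
  refine ⟨((Filter.hyperfilter ℕ).bind (blocks p)).map toSeq, fun d n P hP => ?_⟩
  have hF : ∀ (Q : (ℕ → VarWord k) → Prop) (m : ℕ) (R : Prop),
      (∀ N ≥ m, (∀ᶠ l in blocks p N, Q (toSeq l)) ↔ R) →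
      ((∀ᶠ b in ((Filter.hyperfilter ℕ).bind (blocks p)).map toSeq, Q b) ↔ R) := by
    intro Q m R h
    change (∀ᶠ N in (Filter.hyperfilter ℕ : Filter ℕ), ∀ᶠ l in blocks p N, Q (toSeq l)) ↔ R
    rw [Filter.eventually_congr (q := fun _ => R), Filter.eventually_const]
    exact Nat.hyperfilter_le_atTop (Filter.eventually_atTop.2 ⟨m, h⟩)
  have hP' : ∀ φ φ' : Word k → Word k, (∀ v : Word k, v.1.length ≤ n → φ v = φ' v) →
      (P φ ↔ P φ') := fun φ φ' h => ⟨hP _ _ h, hP _ _ fun v hv => (h v hv).symm⟩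
  have hgood : ∀ m, ∀ᶠ l : List (List (Option (Fin k))) in blocks p m,
      l.length = m ∧ ∀ b ∈ l, none ∈ b := fun m =>
    (eventually_blocks_length p m).and (eventually_blocks_forall p hp m)
  rw [hF (fun b => P (subspaceMap b)) n (∀ᶠ l in blocks p n, P (subspaceMap (toSeq l)))]
  · set ds : List (List (Option (Fin k))) := (List.range n).map fun i => (d i).symbols with hds
    have hdn : ds.length = n := by simp [hds]
    have hcomb := eventually_combineAll (p := p) ds (fun s hs => by
      obtain ⟨i, -, rfl⟩ := List.mem_map.1 hs
      exact (eventually_combine hpp hpq hqp hqq hfill _).1 (d i).wildcard_mem)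
    rw [hdn] at hcomb
    refine hF _ (ds.map List.length).sum _ fun N hN => ?_
    rw [← hcomb, ← eventually_blocks_take p _ N hN]
    refine Filter.eventually_congr ?_
    have h1 := (eventually_blocks_take p _ N hN _).2 ((hcomb _).2 (hgood n))
    filter_upwards [hgood N, h1] with l hl hl'
    refine hP' _ _ fun v hv => Subtype.ext ?_
    have hdv : (subspaceMap d v).1 = substitute ds v.1 :=
      subspaceMap_eq_substitute _ _ _ fun i hi => by
        have : i < n := hi.trans_le hv
        simp [hds, this]
    have hlen := length_substitute_le ds v.1
    rw [subspaceMap_toSeq _ hl'.2 _ (hv.trans hl'.1.ge), subspaceMap_toSeq _ hl.2 _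
      (by rw [hdv, hl.1]; exact hlen.trans hN), hdv,
      ← substitute_substitute _ _ _ (by simp [hl.1]; omega),
      substitute_take _ _ _ hlen]
  · intro N hN
    rw [← eventually_blocks_take p _ N hN]
    refine Filter.eventually_congr ?_
    have h1 := (eventually_blocks_take p _ N hN _).2 (hgood n)
    filter_upwards [hgood N, h1] with l hl hl'
    refine hP' _ _ fun v hv => Subtype.ext ?_
    rw [subspaceMap_toSeq _ hl'.2 _ (hv.trans hl'.1.ge), subspaceMap_toSeq _ hl.2 _
      (hv.trans (hN.trans hl.1.ge)), substitute_take _ _ _ hv]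

/-! ### Strongly stationary limits -/

open Filter Topology in
/-- Every law on `Z^{[k]^ω}`, `Z` compact metrizable, has a strongly stationary limit along
subspaces. -/
theorem exists_stronglyStationary_limit {k : ℕ} [NeZero k] {Z : Type u} [TopologicalSpace Z]
    [CompactSpace Z] [TopologicalSpace.MetrizableSpace Z] [MeasurableSpace Z] [BorelSpace Z]
    (ρ : ProbabilityMeasure (Word k → Z)) :
    ∃ (F : Ultrafilter (ℕ → VarWord k)) (ν : ProbabilityMeasure (Word k → Z)),
      StronglyStationary (ν : Measure (Word k → Z)) ∧
      Tendsto (fun b => ρ.map (f := fun x v => x (subspaceMap b v))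
        (measurable_pi_lambda _ fun _ => measurable_pi_apply _).aemeasurable) F (𝓝 ν) := by
  obtain ⟨F, hF⟩ := exists_ultrafilter_subspace k
  have hmeas : ∀ φ : Word k → Word k, Measurable fun (x : Word k → Z) v => x (φ v) := fun φ =>
    measurable_pi_lambda _ fun _ => measurable_pi_apply _
  have hcont : ∀ φ : Word k → Word k, Continuous fun (x : Word k → Z) v => x (φ v) := fun φ => by
    fun_prop
  obtain ⟨ν, -, hν⟩ := isCompact_univ (X := ProbabilityMeasure (Word k → Z))
    |>.ultrafilter_le_nhds (F.map fun b => ρ.map (hmeas (subspaceMap b)).aemeasurable) (by simp)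
  refine ⟨F, ν, fun d => ?_, hν⟩
  have hlim : Tendsto (fun b => ρ.map (hmeas (subspaceMap b)).aemeasurable) F (𝓝 ν) := hν
  have hmapmap : ∀ (κ : ProbabilityMeasure (Word k → Z)) {A : Type u} [MeasurableSpace A]
      (f : (Word k → Z) → A) (hf : Measurable f) (φ : Word k → Word k),
      (κ.map (hmeas φ).aemeasurable).map hf.aemeasurable =
        κ.map (hf.comp (hmeas φ)).aemeasurable := fun κ A _ f hf φ => by
    exact Subtype.ext (Measure.map_map hf (hmeas φ))
  refine IsProjectiveLimit.unique (P := fun J : Finset (Word k) =>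
    (ν : Measure (Word k → Z)).map J.restrict) (fun J => ?_) (fun J => rfl)
  have hJm : Measurable (J.restrict : (Word k → Z) → _) := Finset.measurable_restrict J
  have hJc : Continuous (J.restrict : (Word k → Z) → _) := by
    unfold Finset.restrict; fun_prop
  have hJdm := hJm.comp (hmeas (subspaceMap d))
  have hJdc := hJc.comp (hcont (subspaceMap d))
  have h1 := ProbabilityMeasure.tendsto_map_of_tendsto_of_continuous _ _ hlim hJdc
  have h2 := ProbabilityMeasure.tendsto_map_of_tendsto_of_continuous _ _ hlim hJc
  -- If the two limits differed, disjoint neighbourhoods would separate them. Membership in one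
  -- depends only on the images of the finitely many words of `J`, so the ultrafilter cannot tell φ
  -- ∘ d from φ.
  have heq : ν.map hJdm.aemeasurable = ν.map hJm.aemeasurable := by
    by_contra hne
    obtain ⟨U, V, hU, hV, hxU, hxV, hUV⟩ := t2_separation hne
    have e1 : ∀ᶠ b in (F : Filter (ℕ → VarWord k)),
        ρ.map (hJdm.comp (hmeas (subspaceMap b))).aemeasurable ∈ U := by
      filter_upwards [h1.eventually (hU.mem_nhds hxU)] with b hb
      rwa [hmapmap ρ _ hJdm] at hb
    have e2 : ∀ᶠ b in (F : Filter (ℕ → VarWord k)),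
        ρ.map (hJm.comp (hmeas (subspaceMap b))).aemeasurable ∈ V := by
      filter_upwards [h2.eventually (hV.mem_nhds hxV)] with b hb
      rwa [hmapmap ρ _ hJm] at hb
    have := (hF d (J.sup fun v => v.1.length) (fun φ =>
      ρ.map (hJm.comp (hmeas φ)).aemeasurable ∈ U) (fun φ φ' h hφ => by
        have : (J.restrict ∘ fun (x : Word k → Z) v => x (φ v)) =
            J.restrict ∘ fun (x : Word k → Z) v => x (φ' v) := by
          funext x w
          simp only [Function.comp_apply, Finset.restrict]
          rw [h w.1 (Finset.le_sup (f := fun v : Word k => v.1.length) w.2)]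
        simpa only [this] using hφ)).1 e1
    obtain ⟨b, hbU, hbV⟩ := (this.and e2).exists
    exact Set.disjoint_left.1 hUV hbU hbV
  rw [Measure.map_map hJm (hmeas _)]
  exact congrArg Subtype.val heq

/-! ### Compact models of standard Borel spaces -/

/-- The σ-algebra of a standard Borel space is the Borel σ-algebra of a compact metrizable
topology. -/
theorem exists_compact_topology (X : Type u) [MeasurableSpace X] [StandardBorelSpace X] :
    ∃ _ : TopologicalSpace X, CompactSpace X ∧ TopologicalSpace.MetrizableSpace X ∧
      BorelSpace X := by
  have key : ∀ (K : Set ℝ), IsCompact K → (X ≃ᵐ K) → ∃ _ : TopologicalSpace X,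
      CompactSpace X ∧ TopologicalSpace.MetrizableSpace X ∧ BorelSpace X := by
    intro K hK f
    have : CompactSpace K := isCompact_iff_compactSpace.1 hK
    let t : TopologicalSpace X := TopologicalSpace.induced f inferInstance
    let g : X ≃ₜ K := f.toEquiv.toHomeomorphOfIsInducing ⟨rfl⟩
    refine ⟨t, g.symm.compactSpace, g.isEmbedding.metrizableSpace, ⟨?_⟩⟩
    have hK : MeasurableSpace.comap f (borel K) = borel X := borel_comap.symm
    rw [← f.measurableEmbedding.comap_eq, ← hK, ← BorelSpace.measurable_eq (α := K)]
  have hIcc : ¬ Countable (Set.Icc (0 : ℝ) 1) := by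
    rw [Set.countable_coe_iff, ← Cardinal.le_aleph0_iff_set_countable,
      Cardinal.mk_Icc_real zero_lt_one]
    exact not_le.2 Cardinal.aleph0_lt_continuum
  by_cases hX : Countable X
  · cases finite_or_infinite X with
    | inl hfin =>
      let t : TopologicalSpace X := ⊥
      have : DiscreteTopology X := ⟨rfl⟩
      exact ⟨t, inferInstance, inferInstance, inferInstance⟩
    | inr hinf =>
      -- The model of a countably infinite space is the convergent sequence 1/(n+1) with its limit
      -- 0.
      have hK := (tendsto_one_div_add_atTop_nhds_zero_nat (𝕜 := ℝ)).isCompact_insert_range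
      have hinj : Function.Injective fun n : ℕ => (1 : ℝ) / (n + 1) := fun m n h => by
        simpa using h
      have hKinf : Infinite ↥(insert 0 (Set.range fun n : ℕ => (1 : ℝ) / (n + 1))) :=
        ((Set.infinite_range_of_injective hinj).mono (Set.subset_insert _ _)).to_subtype
      have hKc : Countable ↥(insert 0 (Set.range fun n : ℕ => (1 : ℝ) / (n + 1))) :=
        ((Set.countable_range _).insert _).to_subtype
      obtain ⟨e₁⟩ := nonempty_denumerable X
      obtain ⟨e₂⟩ := nonempty_denumerable ↥(insert 0 (Set.range fun n : ℕ => (1 : ℝ) / (n + 1)))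
      let e : X ≃ ↥(insert 0 (Set.range fun n : ℕ => (1 : ℝ) / (n + 1))) := Denumerable.equiv₂ _ _
      exact key _ hK ⟨e, measurable_of_countable _, measurable_of_countable _⟩
  · exact key _ isCompact_Icc (PolishSpace.measurableEquivOfNotCountable hX hIcc)

/-! ### Letter maps -/

section Letters

variable {k : ℕ}

/-- Apply a map of the alphabet to all letters of a word. -/
def Word.mapLetters (g : Fin k → Fin k) (w : Word k) : Word k :=
  ⟨w.1.map g, by simpa using w.2⟩

/-- Apply a map of the alphabet to the fixed letters of a variable word. -/
def VarWord.mapLetters (g : Fin k → Fin k) (b : VarWord k) : VarWord k :=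
  ⟨b.symbols.map (Option.map g), List.mem_map.2 ⟨none, b.wildcard_mem, rfl⟩⟩

theorem VarWord.subst_mapLetters (g : Fin k → Fin k) (b : VarWord k) (a : Fin k) :
    (b.mapLetters g).subst (g a) = (b.subst a).map g := by
  simp only [VarWord.subst, VarWord.mapLetters, List.map_map]
  refine List.map_congr_left fun s _ => ?_
  cases s <;> rfl

theorem VarWord.mapLetters_line (g : Fin k → Fin k) (b : VarWord k) (a : Fin k) :
    (b.line a).mapLetters g = (b.mapLetters g).line (g a) :=
  Subtype.ext (b.subst_mapLetters g a).symm

/-- This intertwining shows that the law of x ∘ g is unchanged along subspaces, which identifies the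
second marginal of the coupling. -/
theorem mapLetters_subspaceMap (g : Fin k → Fin k) (b : ℕ → VarWord k) (v : Word k) :
    (subspaceMap b v).mapLetters g = subspaceMap (fun n => (b n).mapLetters g) (v.mapLetters g) := by
  obtain ⟨v, hv⟩ := v
  refine Subtype.ext ?_
  simp only [Word.mapLetters, subspaceMap]
  clear hv
  induction v generalizing b with
  | nil => rfl
  | cons a v ih =>
    simp only [List.mapIdx_cons, List.flatten_cons, List.map_append, List.map_cons,
      VarWord.subst_mapLetters]
    rw [ih fun n => b (n + 1)]

/-- The map of the alphabet which sends the letters of `e` to `i` and fixes the others. -/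
def collapse (e : Finset (Fin k)) (i a : Fin k) : Fin k := if a ∈ e then i else a

variable {X : Type u} [MeasurableSpace X]

/-- Changing all letters of `e` in a word does not affect the membership in an `e`-insensitive
set. -/
theorem ae_mem_iff_mapLetters_collapse {μ : Measure (Word k → X)} {e : Finset (Fin k)} {i : Fin k}
    (hi : i ∈ e) {A : Set X} (hA : MeasurableSet[insensitive μ e] A) (w : Word k) :
    ∀ᵐ x ∂μ, x w ∈ A ↔ x (w.mapLetters (collapse e i)) ∈ A := by
  -- Letters are changed one at a time from the right, each along a line with a single wildcard; `u`
  -- is the untouched prefix.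
  have key : ∀ (v u : List (Fin k)) (h : u ++ v ≠ []) (h' : u ++ v.map (collapse e i) ≠ []),
      ∀ᵐ x ∂μ, x ⟨u ++ v, h⟩ ∈ A ↔ x ⟨u ++ v.map (collapse e i), h'⟩ ∈ A := by
    intro v
    induction v with
    | nil => intro u h h'; simp
    | cons a v ih =>
      intro u h h'
      have h1 := ih (u ++ [a]) (by simp) (by simp)
      by_cases ha : a ∈ e
      · have h2 := hA.2 ⟨u.map some ++ none :: (v.map (collapse e i)).map some, by simp⟩ a ha i hi
        simp only [VarWord.line, VarWord.subst, List.map_append, List.map_map, List.map_cons,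
          Function.comp_def, Option.getD_some, Option.getD_none, List.map_id'] at h2
        filter_upwards [h1, h2] with x hx1 hx2
        simp only [List.append_assoc, List.singleton_append] at hx1
        simp only [List.map_cons, collapse, ha, if_true]
        exact hx1.trans hx2
      · simpa [collapse, ha] using h1
  exact key w.1 [] _ _

theorem ae_eq_mapLetters_collapse {μ : Measure (Word k → X)} {e : Finset (Fin k)} {i : Fin k}
    (hi : i ∈ e) {d : X → ℝ} (hd : IsInsensitive μ e d) (w : Word k) :
    ∀ᵐ x ∂μ, d (x w) = d (x (w.mapLetters (collapse e i))) := by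
  have h : ∀ r : ℚ, ∀ᵐ x ∂μ, d (x w) < r ↔ d (x (w.mapLetters (collapse e i))) < r := fun r =>
    ae_mem_iff_mapLetters_collapse hi (A := d ⁻¹' Set.Iio (r : ℝ)) (hd measurableSet_Iio) w
  filter_upwards [ae_all_iff.2 h] with x hx
  refine le_antisymm ?_ ?_ <;> refine le_of_forall_rat_lt_imp_le fun r hr => ?_
  · by_contra hlt
    exact absurd ((hx r).2 (not_le.1 hlt)) hr.le.not_gt
  · by_contra hlt
    exact absurd ((hx r).1 (not_le.1 hlt)) hr.le.not_gt

end Letters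

/-! ### The coupling of a law with its image under a letter map -/

/-- Exchanges an L¹ function for a continuous approximation with an error depending only on the
common marginal, hence uniform along the limit. -/
theorem integral_abs_sub_le {Ω X : Type*} [MeasurableSpace Ω] [MeasurableSpace X] {m : Measure Ω}
    {κ : Measure X} {u v : Ω → X} (hu : MeasurePreserving u m κ) (hv : MeasurePreserving v m κ)
    {d h : X → ℝ} (hd : Integrable d κ) (hh : Integrable h κ) :
    ∫ x, |h (u x) - h (v x)| ∂m ≤ ∫ x, |d (u x) - d (v x)| ∂m + 2 * ∫ x, |d x - h x| ∂κ := by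
  have e1 : ∫ x, |d (u x) - h (u x)| ∂m = ∫ x, |d x - h x| ∂κ := by
    rw [← hu.map_eq, integral_map hu.aemeasurable]
    exact (hu.map_eq ▸ (hd.sub hh).abs.aestronglyMeasurable)
  have e2 : ∫ x, |d (v x) - h (v x)| ∂m = ∫ x, |d x - h x| ∂κ := by
    rw [← hv.map_eq, integral_map hv.aemeasurable]
    exact (hv.map_eq ▸ (hd.sub hh).abs.aestronglyMeasurable)
  have du := hu.integrable_comp_of_integrable hd
  have dv := hv.integrable_comp_of_integrable hd
  have hu' := hu.integrable_comp_of_integrable hh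
  have hv' := hv.integrable_comp_of_integrable hh
  have i1 : Integrable (fun x => |d (u x) - d (v x)|) m := (du.sub dv).abs
  have i2 : Integrable (fun x => |d (u x) - h (u x)|) m := (du.sub hu').abs
  have i3 : Integrable (fun x => |d (v x) - h (v x)|) m := (dv.sub hv').abs
  have i4 : Integrable (fun x => |h (u x) - h (v x)|) m := (hu'.sub hv').abs
  calc ∫ x, |h (u x) - h (v x)| ∂m
      ≤ ∫ x, (|d (u x) - d (v x)| + (|d (u x) - h (u x)| + |d (v x) - h (v x)|)) ∂m := by
        refine integral_mono i4 (i1.add (i2.add i3)) fun x => ?_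
        have := abs_sub_le (h (u x)) (d (u x)) (h (v x))
        have := abs_sub_le (d (u x)) (d (v x)) (h (v x))
        have := abs_sub_comm (h (u x)) (d (u x))
        simp only
        linarith
    _ = _ := by
        have h1 := integral_add i1 (i2.add i3)
        have h2 := integral_add i2 i3
        simp only [Pi.add_apply] at h1
        rw [h1, h2, e1, e2]
        ring

open Filter Topology in
/-- A strongly stationary law `μ` has a strongly stationary self-coupling, in which the second
process has the law of `x ∘ g`, for a given map `g` of the alphabet, and functions which do not
distinguish `x_w` and `x_{g w}` do not distinguish the coordinates. -/
theorem exists_coupling {k : ℕ} [NeZero k] {X : Type u} [MeasurableSpace X] [StandardBorelSpace X]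
    (μ : Measure (Word k → X)) [IsProbabilityMeasure μ] (hμ : StronglyStationary μ)
    (g : Fin k → Fin k) :
    ∃ ν : Measure (Word k → X × X), IsProbabilityMeasure ν ∧ StronglyStationary ν ∧
      ν.map (fun y w => (y w).1) = μ ∧
      ν.map (fun y w => (y w).2) = μ.map (fun x w => x (w.mapLetters g)) ∧
      ∀ d : X → ℝ, Integrable d (pointMarginal μ) →
        (∀ w, ∀ᵐ x ∂μ, d (x w) = d (x (w.mapLetters g))) →
        ∀ w, ∀ᵐ y ∂ν, d (y w).1 = d (y w).2 := by
  obtain ⟨_, _, _, _⟩ := exists_compact_topology X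
  let _ := TopologicalSpace.metrizableSpaceMetric X
  have hc : Measurable fun (x : Word k → X) w => (x w, x (w.mapLetters g)) := by fun_prop
  have hred : ∀ φ : Word k → Word k, Measurable fun (x : Word k → X × X) v => x (φ v) := fun φ => by
    fun_prop
  have hfst : Measurable fun (y : Word k → X × X) w => (y w).1 := by fun_prop
  have hsnd : Measurable fun (y : Word k → X × X) w => (y w).2 := by fun_prop
  have hfstc : Continuous fun (y : Word k → X × X) w => (y w).1 := by fun_prop
  have hsndc : Continuous fun (y : Word k → X × X) w => (y w).2 := by fun_prop
  let μ' : ProbabilityMeasure (Word k → X) := ⟨μ, inferInstance⟩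
  let ρ : ProbabilityMeasure (Word k → X × X) := μ'.map hc.aemeasurable
  obtain ⟨F, ν, hν, hlim⟩ := exists_stronglyStationary_limit ρ
  have hb : ∀ b, ((ρ.map (hred (subspaceMap b)).aemeasurable :
      ProbabilityMeasure _) : Measure (Word k → X × X)) =
      μ.map fun x v => (x (subspaceMap b v), x ((subspaceMap b v).mapLetters g)) := fun b =>
    Measure.map_map (hred _) hc
  have h1 : (ν : Measure (Word k → X × X)).map (fun y w => (y w).1) = μ := by
    have h := ProbabilityMeasure.tendsto_map_of_tendsto_of_continuous _ _ hlim hfstc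
    have h' : ∀ b, (ρ.map (hred (subspaceMap b)).aemeasurable).map hfst.aemeasurable =
        μ' := fun b => by
      refine Subtype.ext ?_
      change Measure.map _ (ρ.map (hred (subspaceMap b)).aemeasurable).toMeasure = μ
      rw [hb, Measure.map_map hfst (by fun_prop)]
      exact hμ b
    have heq := tendsto_nhds_unique h (tendsto_const_nhds.congr fun b => (h' b).symm)
    exact congrArg Subtype.val heq
  have h2 : (ν : Measure (Word k → X × X)).map (fun y w => (y w).2) =
      μ.map (fun x w => x (w.mapLetters g)) := by
    have h := ProbabilityMeasure.tendsto_map_of_tendsto_of_continuous _ _ hlim hsndc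
    have hg : Measurable fun (x : Word k → X) w => x (Word.mapLetters g w) := by fun_prop
    have h' : ∀ b, (ρ.map (hred (subspaceMap b)).aemeasurable).map hsnd.aemeasurable =
        μ'.map hg.aemeasurable := fun b => by
      refine Subtype.ext ?_
      change Measure.map _ (ρ.map (hred (subspaceMap b)).aemeasurable).toMeasure = μ.map _
      rw [hb, Measure.map_map hsnd (by fun_prop)]
      -- Stationarity of μ is used for the subspace with letters changed by g.
      nth_rw 2 [← hμ fun n => (b n).mapLetters g]
      rw [Measure.map_map hg (by fun_prop)]
      congr 1
      funext x v
      simp [mapLetters_subspaceMap]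
    have heq := tendsto_nhds_unique h (tendsto_const_nhds.congr fun b => (h' b).symm)
    exact congrArg Subtype.val heq
  refine ⟨ν, inferInstance, hν, h1, h2, fun d hd hdg w => ?_⟩
  have p1 : MeasurePreserving (fun y : Word k → X × X => (y w).1) ν (pointMarginal μ) := by
    refine ⟨by fun_prop, ?_⟩
    have := congrArg (Measure.map fun x : Word k → X => x w) h1
    rw [Measure.map_map (measurable_pi_apply w) hfst] at this
    exact this.trans (hμ.map_eval _)
  have p2 : MeasurePreserving (fun y : Word k → X × X => (y w).2) ν (pointMarginal μ) := by
    refine ⟨by fun_prop, ?_⟩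
    have := congrArg (Measure.map fun x : Word k → X => x w) h2
    rw [Measure.map_map (measurable_pi_apply w) hsnd,
      Measure.map_map (measurable_pi_apply w) (by fun_prop)] at this
    exact this.trans (hμ.map_eval _)
  have hint : Integrable (fun y : Word k → X × X => |d (y w).1 - d (y w).2|) ν :=
    ((p1.integrable_comp_of_integrable hd).sub (p2.integrable_comp_of_integrable hd)).abs
  have hzero : ∫ y, |d (y w).1 - d (y w).2| ∂(ν : Measure (Word k → X × X)) = 0 := by
    refine le_antisymm (le_of_forall_pos_le_add fun ε hε => ?_)
      (integral_nonneg fun _ => abs_nonneg _)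
    -- ε / 4 because the approximation is used twice, once before and once after the limit, each
    -- time at cost 2 * (ε / 4).
    obtain ⟨h, hh, hhint⟩ := hd.exists_boundedContinuous_integral_sub_le (ε := ε / 4) (by positivity)
    simp only [Real.norm_eq_abs] at hh
    let G : BoundedContinuousFunction (Word k → X × X) ℝ := BoundedContinuousFunction.mkOfCompact
      ⟨fun y => |h (y w).1 - h (y w).2|, by fun_prop⟩
    have hG := (ProbabilityMeasure.tendsto_iff_forall_integral_tendsto.1 hlim) G
    have hGle : ∫ y, |h (y w).1 - h (y w).2| ∂(ν : Measure (Word k → X × X)) ≤ 2 * (ε / 4) := by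
      refine le_of_tendsto hG (Eventually.of_forall fun b => ?_)
      rw [hb, integral_map (by fun_prop) G.continuous.aestronglyMeasurable]
      change ∫ x, |h (x (subspaceMap b w)) - h (x ((subspaceMap b w).mapLetters g))| ∂μ ≤ _
      refine (integral_abs_sub_le (κ := pointMarginal μ) ⟨by fun_prop, hμ.map_eval _⟩
        ⟨by fun_prop, hμ.map_eval _⟩ hd hhint).trans ?_
      rw [integral_eq_zero_of_ae]
      · linarith
      · filter_upwards [hdg (subspaceMap b w)] with x hx
        simp [hx]
    have := integral_abs_sub_le p1 p2 hhint hd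
    simp only [abs_sub_comm (h _) (d _)] at this
    linarith
  filter_upwards [(integral_eq_zero_iff_of_nonneg (fun _ => abs_nonneg _) hint).1 hzero] with y hy
  exact sub_eq_zero.1 (abs_eq_zero.1 hy)

/-! ### Conditional independence -/

/-- If `m₁` and `m₂` are conditionally independent over `H ≤ m₁`, then an `m₁`-measurable function
with zero conditional expectation on `H` has zero integral on the sets of `m₂`. -/
theorem setIntegral_eq_zero_of_condIndep {Ω : Type*} {H m₁ m₂ mΩ : MeasurableSpace Ω}
    [StandardBorelSpace Ω] {ν : Measure Ω} [IsProbabilityMeasure ν] (hH : H ≤ mΩ)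
    (hHm₁ : H ≤ m₁) (hm₁ : m₁ ≤ mΩ) (hm₂ : m₂ ≤ mΩ) (hind : CondIndep H m₁ m₂ hH ν) {D : Ω → ℝ}
    (hD : StronglyMeasurable[m₁] D) (hDi : Integrable D ν) (hD0 : ν[D | H] =ᵐ[ν] 0) {B : Set Ω}
    (hB : MeasurableSet[m₂] B) : ∫ y in B, D y ∂ν = 0 := by
  rw [condIndep_iff _ _ _ hH hm₁ hm₂] at hind
  have hBm : MeasurableSet B := hm₂ _ hB
  have hBi : Integrable (B.indicator fun _ => (1 : ℝ)) ν := (integrable_const 1).indicator hBm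
  set W : Ω → ℝ := ν[B.indicator (fun _ => (1 : ℝ)) | H] with hW
  have hWsm : StronglyMeasurable[H] W := stronglyMeasurable_condExp
  have hWb : ∀ᵐ y ∂ν, ‖W y‖ ≤ 1 :=
    ae_bdd_abs_condExp_of_ae_bdd_abs (R := 1) (Filter.Eventually.of_forall fun y => by
      by_cases hy : y ∈ B <;> simp [hy])
  have hmulW : ∀ {g : Ω → ℝ}, Integrable g ν → Integrable (W * g) ν := fun hg =>
    hg.bdd_mul (hWsm.mono hH).aestronglyMeasurable hWb
  -- The equivalent form of conditional independence: given m₁, the prediction of `B` uses only H.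
  have hWm₁ : ν[B.indicator (fun _ => (1 : ℝ)) | m₁] =ᵐ[ν] W := by
    refine (ae_eq_condExp_of_forall_setIntegral_eq hm₁ hBi
      (fun _ _ _ => integrable_condExp.integrableOn) (fun A hA _ => ?_)
      (hWsm.mono hHm₁).aestronglyMeasurable).symm
    have hAm : MeasurableSet A := hm₁ _ hA
    have hAi : Integrable (A.indicator fun _ => (1 : ℝ)) ν := (integrable_const 1).indicator hAm
    have e1 : ∫ y in A, W y ∂ν = ∫ y, (W * A.indicator fun _ => (1 : ℝ)) y ∂ν := by
      rw [← integral_indicator hAm]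
      congr 1
      funext y
      by_cases hy : y ∈ A <;> simp [hy]
    have e2 : ∫ y in A, B.indicator (fun _ => (1 : ℝ)) y ∂ν =
        ∫ y, (A ∩ B).indicator (fun _ => (1 : ℝ)) y ∂ν := by
      rw [← integral_indicator hAm, Set.indicator_indicator]
    rw [e1, e2, ← integral_condExp hH, ← integral_condExp (f := (A ∩ B).indicator _) hH]
    refine integral_congr_ae ?_
    filter_upwards [condExp_mul_of_stronglyMeasurable_left hWsm (hmulW hAi) hAi, hind A B hA hB]
      with y h1 h2
    rw [h1, h2, Pi.mul_apply, Pi.mul_apply, mul_comm]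
  have hDB : Integrable (D * B.indicator fun _ => (1 : ℝ)) ν := by
    rw [mul_comm]
    exact hDi.bdd_mul (c := 1) hBi.aestronglyMeasurable (Filter.Eventually.of_forall fun y => by
      by_cases hy : y ∈ B <;> simp [hy])
  calc ∫ y in B, D y ∂ν = ∫ y, (D * B.indicator fun _ => (1 : ℝ)) y ∂ν := by
        rw [← integral_indicator hBm]
        congr 1
        funext y
        by_cases hy : y ∈ B <;> simp [hy]
    _ = ∫ y, (W * D) y ∂ν := by
        rw [← integral_condExp hm₁]
        refine integral_congr_ae ?_
        filter_upwards [condExp_mul_of_stronglyMeasurable_left hD hDB hBi, hWm₁] with y h1 h2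
        rw [h1, Pi.mul_apply, Pi.mul_apply, h2, mul_comm]
    _ = 0 := by
        rw [← integral_condExp hH]
        refine integral_eq_zero_of_ae ?_
        filter_upwards [condExp_mul_of_stronglyMeasurable_left hWsm (hmulW hDi) hDi, hD0]
          with y h1 h2
        simp [h1, h2]

/-- The conditional expectation of a composition with a measure preserving map. -/
theorem condExp_comp_eq_zero {Ω X : Type*} [MeasurableSpace Ω] {m mX : MeasurableSpace X}
    {ν : Measure Ω} {κ : Measure X} [IsProbabilityMeasure κ] [IsProbabilityMeasure ν] {π : Ω → X}
    (hπ : MeasurePreserving π ν κ)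
    (hm : m ≤ mX) {d : X → ℝ} (hd : Integrable d κ)
    (hd0 : κ[d | m] =ᵐ[κ] 0) : ν[d ∘ π | m.comap π] =ᵐ[ν] 0 := by
  have hle : m.comap π ≤ ‹MeasurableSpace Ω› :=
    (MeasurableSpace.comap_mono hm).trans hπ.measurable.comap_le
  refine (ae_eq_condExp_of_forall_setIntegral_eq hle (hπ.integrable_comp_of_integrable hd)
    (fun _ _ _ => integrableOn_zero) ?_ stronglyMeasurable_zero.aestronglyMeasurable).symm
  rintro _ ⟨C, hC, rfl⟩ -
  have hz : ∫ x in C, d x ∂κ = 0 := by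
    rw [← setIntegral_condExp hm hd hC]
    exact integral_eq_zero_of_ae (ae_restrict_of_ae hd0)
  have : ∫ y in π ⁻¹' C, d (π y) ∂ν = ∫ x in C, d x ∂κ := by
    rw [← hπ.map_eq, setIntegral_map (hm _ hC) (hπ.map_eq ▸ hd.aestronglyMeasurable)
      hπ.aemeasurable]
  simp only [Function.comp_apply, this, hz, integral_zero]

/-! ### Insensitive σ-algebras of the coupling -/

section Insensitive

variable {k : ℕ} {X : Type u} [MeasurableSpace X]

theorem insensitive_anti (μ : Measure (Word k → X)) {e e' : Finset (Fin k)} (h : e ⊆ e') :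
    insensitive μ e' ≤ insensitive μ e :=
  fun _ hA => ⟨hA.1, fun ℓ a ha b hb => hA.2 ℓ a (h ha) b (h hb)⟩

/-- If the second process of `ν` is distributed like `x ∘ collapse e i`, then the sets of `Φ_{i,j}`
are `e ∪ {j}`-insensitive as sets of the second coordinate. -/
theorem measurableSet_insensitive_snd {μ : Measure (Word k → X)} {ν : Measure (Word k → X × X)}
    {e : Finset (Fin k)} {i j : Fin k}
    (h : ν.map (fun y w => (y w).2) = μ.map fun x w => x (w.mapLetters (collapse e i)))
    {A : Set X} (hA : MeasurableSet[insensitive μ {i, j}] A) :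
    MeasurableSet[insensitive ν (e ∪ {j})] (Prod.snd ⁻¹' A) := by
  have hAm : MeasurableSet A := hA.1
  refine ⟨measurable_snd hAm, fun ℓ a ha b hb => ?_⟩
  have hcol : ∀ a ∈ e ∪ {j}, collapse e i a ∈ ({i, j} : Finset (Fin k)) := fun a ha => by
    by_cases hae : a ∈ e
    · simp [collapse, hae]
    · obtain rfl : a = j := by simpa [hae] using ha
      simp [collapse, hae]
  have hm : MeasurableSet {x : Word k → X | x (ℓ.line a) ∈ A ↔ x (ℓ.line b) ∈ A} :=
    MeasurableSet.iff (measurable_pi_apply _ hAm) (measurable_pi_apply _ hAm)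
  refine ae_of_ae_map (f := fun (y : Word k → X × X) w => (y w).2)
    (p := fun x : Word k → X => x (ℓ.line a) ∈ A ↔ x (ℓ.line b) ∈ A)
    (Measurable.aemeasurable (by fun_prop)) ?_
  rw [h, ae_map_iff (Measurable.aemeasurable (by fun_prop)) hm]
  simp only [VarWord.mapLetters_line]
  exact hA.2 _ _ (hcol a ha) _ (hcol b hb)

/-- The letter map only moves the base word to another word, and all point marginals of μ coincide.
Thus both coordinates of the coupling have law μ°, although the second process need not have law μ.
-/
theorem StronglyStationary.measurePreserving_pointMarginal [NeZero k] {Y : Type u}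
    [MeasurableSpace Y] {μ : Measure (Word k → X)} (hμ : StronglyStationary μ)
    {ν : Measure (Word k → Y)} {π : Y → X} (hπ : Measurable π) (g : Fin k → Fin k)
    (h : ν.map (fun y w => π (y w)) = μ.map fun x w => x (w.mapLetters g)) :
    MeasurePreserving π (pointMarginal ν) (pointMarginal μ) := by
  refine ⟨hπ, ?_⟩
  have := congrArg (Measure.map fun x : Word k → X => x (baseWord k)) h
  rw [Measure.map_map (measurable_pi_apply _) (by fun_prop),
    Measure.map_map (measurable_pi_apply _) (by fun_prop)] at this
  rw [pointMarginal, Measure.map_map hπ (measurable_pi_apply _)]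
  exact this.trans (hμ.map_eval _)

end Insensitive

end DHJ

/-! ### The lemma, from satedness applied to the coupling -/

theorem lemma6p1 {k : ℕ} [NeZero k] {X : Type*} [MeasurableSpace X] [StandardBorelSpace X]
    (μ : Measure (DHJ.Word k → X)) [IsProbabilityMeasure μ]
    (hstat : DHJ.StronglyStationary μ) (hsat : DHJ.FullySated μ)
    (e : Finset (Fin k)) (he : 2 ≤ e.card) (i : Fin k) (hi : i ∈ e)
    (f : X → ℝ) (hf : MemLp f ∞ (DHJ.pointMarginal μ)) (hfe : DHJ.IsInsensitive μ e f) :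
    (DHJ.pointMarginal μ)[f | ⨆ j ∈ eᶜ, DHJ.insensitive μ {i, j}]
      =ᵐ[DHJ.pointMarginal μ]
    (DHJ.pointMarginal μ)[f | ⨆ j ∈ eᶜ, DHJ.insensitive μ (e ∪ {j})] := by
  open DHJ in
  obtain hec | ⟨j₀, hj₀⟩ := eᶜ.eq_empty_or_nonempty
  · simp [hec]
  -- The up-set generated by the e ∪ {j}; larger members add nothing to the join since Φ_u decreases
  -- in u.
  let I : Set (Finset (Fin k)) := {u | ∃ j ∈ eᶜ, e ∪ {j} ⊆ u}
  have hI : IsUpFamily I := by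
    refine ⟨?_, ?_⟩
    · rintro u ⟨j, -, hj⟩
      exact he.trans (Finset.card_le_card (Finset.subset_union_left.trans hj))
    · rintro u ⟨j, hje, hj⟩ v huv
      exact ⟨j, hje, hj.trans huv⟩
  have hfam : ∀ {Y : Type _} [MeasurableSpace Y] (κ : Measure (Word k → Y)),
      familyInsensitive κ I = ⨆ j ∈ eᶜ, insensitive κ (e ∪ {j}) := fun κ => by
    refine le_antisymm (iSup₂_le ?_) (iSup₂_le fun j hj => ?_)
    · rintro u ⟨j, hje, hj⟩
      exact (insensitive_anti κ hj).trans (le_iSup₂_of_le j hje le_rfl)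
    · exact le_iSup₂_of_le (e ∪ {j}) ⟨j, hj, subset_rfl⟩ le_rfl
  have hmX := familyInsensitive_le μ I
  have hHe : familyInsensitive μ I ≤ insensitive μ e := by
    rw [hfam]
    exact iSup₂_le fun j _ => insensitive_anti μ Finset.subset_union_left
  have hHG : familyInsensitive μ I ≤ ⨆ j ∈ eᶜ, insensitive μ {i, j} := by
    rw [hfam]
    refine iSup₂_mono fun j _ => insensitive_anti μ ?_
    intro a ha
    simp only [Finset.mem_insert, Finset.mem_singleton] at ha
    rcases ha with rfl | rfl <;> simp [hi]
  have hGm : ⨆ j ∈ eᶜ, insensitive μ {i, j} ≤ ‹MeasurableSpace X› :=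
    iSup₂_le fun j _ => insensitive_le μ _
  rw [← hfam μ]
  have hfi : Integrable f (pointMarginal μ) := hf.integrable le_top
  obtain ⟨ν, _, hν, hfst, hsnd, hdiag⟩ := exists_coupling μ hstat (collapse e i)
  have pfst : MeasurePreserving Prod.fst (pointMarginal ν) (pointMarginal μ) :=
    hstat.measurePreserving_pointMarginal measurable_fst id (by simpa [Word.mapLetters] using hfst)
  have psnd : MeasurePreserving Prod.snd (pointMarginal ν) (pointMarginal μ) :=
    hstat.measurePreserving_pointMarginal measurable_snd _ hsnd
  have hind := hsat I hI ⟨_, j₀, hj₀, subset_rfl⟩ (X × X) ν Prod.fst ⟨measurable_fst, hfst⟩ hν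
  set E : X → ℝ := (pointMarginal μ)[f | familyInsensitive μ I] with hE
  have hEsm : StronglyMeasurable[familyInsensitive μ I] E := stronglyMeasurable_condExp
  let d : X → ℝ := f - E
  have hde : IsInsensitive μ e d := Measurable.sub hfe (hEsm.mono hHe).measurable
  have hdm : Measurable d := hde.mono (insensitive_le μ e) le_rfl
  have hdi : Integrable d (pointMarginal μ) := hfi.sub integrable_condExp
  have hd0 : (pointMarginal μ)[d | familyInsensitive μ I] =ᵐ[pointMarginal μ] 0 := by
    filter_upwards [condExp_sub hfi (integrable_condExp (f := f) (m := familyInsensitive μ I))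
      (familyInsensitive μ I), condExp_condExp_of_le (f := f) (μ := pointMarginal μ) le_rfl hmX]
      with x h1 h2
    rw [h1, Pi.sub_apply, h2, sub_self, Pi.zero_apply]
  have hdd : ∀ᵐ y ∂(pointMarginal ν), d y.1 = d y.2 := by
    have hms : MeasurableSet {y : X × X | d y.1 = d y.2} :=
      measurableSet_eq_fun (by fun_prop) (by fun_prop)
    refine (ae_map_iff (measurable_pi_apply (baseWord k)).aemeasurable hms).2 ?_
    exact hdiag d hdi (fun w => ae_eq_mapLetters_collapse hi hde w) _
  have hsndG : (⨆ j ∈ eᶜ, insensitive μ {i, j}).comap Prod.snd ≤ familyInsensitive ν I := by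
    rw [hfam, MeasurableSpace.comap_iSup]
    refine iSup_le fun j => ?_
    rw [MeasurableSpace.comap_iSup]
    refine iSup_le fun hj => le_iSup₂_of_le j hj ?_
    rintro _ ⟨A, hA, rfl⟩
    exact measurableSet_insensitive_snd hsnd hA
  refine (ae_eq_condExp_of_forall_setIntegral_eq hGm hfi
    (fun _ _ _ => integrable_condExp.integrableOn) (fun B hB _ => ?_)
    (hEsm.mono hHG).aestronglyMeasurable).symm
  have hBm := hGm _ hB
  -- Move the integral to the second coordinate, replace d(y₂) by d(y₁), and apply satedness to the
  -- set y₂ ∈ B.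
  have hzero : ∫ x in B, d x ∂(pointMarginal μ) = 0 := by
    rw [← psnd.map_eq, setIntegral_map hBm hdm.aestronglyMeasurable psnd.aemeasurable,
      ← integral_congr_ae (ae_restrict_of_ae hdd)]
    exact setIntegral_eq_zero_of_condIndep (comap_familyInsensitive_le μ I measurable_fst)
      (MeasurableSpace.comap_mono hmX) measurable_fst.comap_le (familyInsensitive_le ν I) hind
      (hdm.comp (comap_measurable _)).stronglyMeasurable (pfst.integrable_comp_of_integrable hdi)
      (condExp_comp_eq_zero pfst hmX hdi hd0) (hsndG _ ⟨B, hB, rfl⟩)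
  have := integral_sub (hfi.integrableOn (s := B)) ((integrable_condExp (f := f)
    (m := familyInsensitive μ I) (μ := pointMarginal μ)).integrableOn (s := B))
  exact (sub_eq_zero.1 (this.symm.trans hzero)).symm
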